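/- Let $K$ be an algebraically closed field, $d\ge 2$, and $R=K[X_1,\dots,X_d]$ with the standard grading $\deg X_j=1$. Let $G=\langle\sigma_1,\dots,\sigma_\ell\rangle\subseteq \mathrm{GL}(K^d)$ be a finite group whose order is not divisible by the characteristic of $K$, where each $\sigma_i$ is the diagonal matrix with diagonal entries $\xi_i^{t_{i1}},\dots,\xi_i^{t_{id}}$, with $\xi_i\in K$ a primitive $n_i$-th root of unity ($n_i\ge 1$), $t_{ij}$ non-negative integers, and $\gcd(t_{i1},\dots,t_{id},n_i)=1$ for all $i$. A matrix $\sigma=(a_{ij})\in\mathrm{GL}(K^d)$ acts on $R$ as the $K$-algebra map with $X_j\mapsto\sum_i a_{ij}X_i$. Let $R^G=\{f\in R\mid \sigma(f)=f \text{ for all }\sigma\in G\}$, graded by degree, and let $\mathfrak m_G$ be its graded maximal ideal, i.e. the ideal of invariants with zero constant term. For a character of $G$, that is, a group homomorphism $\mathcal X:G\to K^\times$, let $$R^{\mathcal X}=\{f\in R\mid \sigma(f)=\mathcal X(\sigma)f\text{ for all }\sigma\in G\},$$ an $R^G$-module called the semi-invariants of weight $\mathcal X$. Suppose that $n_1,\dots,n_\ell$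 are pairwise coprime, and that $G$ contains no pseudo-reflection, i.e. no element of finite order whose eigenspace for the eigenvalue $1$ has dimension $d-1$. Set $n=\prod_{i=1}^\ell n_i$. Then the following are equivalent. 1. For each character $\mathcal X$ of $G$, the module $R^{\mathcal X}$ is locally free on the graded punctured spectrum of $R^G$: for every graded prime ideal $\mathfrak p\ne\mathfrak m_G$ of $R^G$, the localization $R^{\mathcal X}_{\mathfrak p}$ is a free $R^G_{\mathfrak p}$-module. 2. For each $1\le j\le d$, the powers $X_j,X_j^2,\dots,X_j^n$ lie in pairwise different semi-invariant modules: for $1\le a<b\le n$ there is no character $\mathcal X$ of $G$ with both $X_j^a\in R^{\mathcal X}$ and $X_j^b\in R^{\mathcal X}$. -/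

import Mathlib

noncomputable section

namespace PolyInvariant

open MvPolynomial

variable {K : Type*} [Field K] {d : ℕ}

/-- The `K`-algebra endomorphism of `R = K[X_1, …, X_d]` attached to a matrix
`σ = (a_{ij}) ∈ GL(K^d)`: it sends `X_j` to `∑ i, a_{ij} X_i`. -/
def act (σ : GL (Fin d) K) : MvPolynomial (Fin d) K →ₐ[K] MvPolynomial (Fin d) K :=
  aeval fun j => ∑ i, C ((σ : Matrix (Fin d) (Fin d) K) i j) * X i

/-- The ring of invariants `R^G`, as a `K`-subalgebra of `R = K[X_1, …, X_d]`. -/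
def invariants (G : Subgroup (GL (Fin d) K)) : Subalgebra K (MvPolynomial (Fin d) K) where
  carrier := {f | ∀ σ ∈ G, act σ f = f}
  mul_mem' hf hg σ hσ := by rw [map_mul, hf σ hσ, hg σ hσ]
  add_mem' hf hg σ hσ := by rw [map_add, hf σ hσ, hg σ hσ]
  algebraMap_mem' c σ _ := by rw [AlgHom.commutes]

/-- The `R^G`-module `R^χ` of semi-invariants of weight `χ`, for a character `χ : G → GL(K) = Kˣ`:
the polynomials `f` with `σ(f) = χ(σ) f` for all `σ ∈ G`. -/
def semiInvariants (G : Subgroup (GL (Fin d) K)) (χ : G →* Kˣ) :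
    Submodule (invariants G) (MvPolynomial (Fin d) K) where
  carrier := {f | ∀ σ : G, act (σ : GL (Fin d) K) f = ((χ σ : Kˣ) : K) • f}
  add_mem' hf hg σ := by rw [map_add, hf σ, hg σ, smul_add]
  zero_mem' σ := by rw [map_zero, smul_zero]
  smul_mem' c f hf σ := by
    rw [Subalgebra.smul_def, smul_eq_mul, map_mul, hf σ, c.2 σ σ.2, mul_smul_comm]

/-- The grading of `R^G` induced by the standard grading of `R` (with `deg X_j = 1`): the degree
`m` part of `R^G` consists of the invariants that are homogeneous of degree `m`. -/
def grading (G : Subgroup (GL (Fin d) K)) (m : ℕ) : Submodule K (invariants G) :=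
  (homogeneousSubmodule (Fin d) K m).comap (invariants G).val.toLinearMap

lemma mem_grading {G : Subgroup (GL (Fin d) K)} {m : ℕ} {f : invariants G} :
    f ∈ grading G m ↔ (f : MvPolynomial (Fin d) K).IsHomogeneous m := Iff.rfl

lemma act_isHomogeneous (σ : GL (Fin d) K) {f : MvPolynomial (Fin d) K} {m : ℕ}
    (hf : f.IsHomogeneous m) : (act σ f).IsHomogeneous m := by
  have h := hf.aeval (fun j => ∑ i, C ((σ : Matrix (Fin d) (Fin d) K) i j) * X i) (n := 1)
    (fun j => IsHomogeneous.sum _ _ _ fun i _ => isHomogeneous_C_mul_X _ _)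
  rwa [one_mul] at h

lemma act_homogeneousComponent (σ : GL (Fin d) K) (f : MvPolynomial (Fin d) K) (m : ℕ) :
    act σ (homogeneousComponent m f) = homogeneousComponent m (act σ f) := by
  conv_rhs => rw [← sum_homogeneousComponent f, map_sum, map_sum]
  have h : ∀ i, homogeneousComponent m (act σ (homogeneousComponent i f)) =
      if i = m then act σ (homogeneousComponent i f) else 0 := fun i => by
    have hi := act_isHomogeneous σ (homogeneousComponent_isHomogeneous i f)
    rw [homogeneousComponent_of_mem hi]
    simp [eq_comm]
  simp only [h, Finset.sum_ite_eq', Finset.mem_range]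
  split_ifs with hm
  · rfl
  · rw [homogeneousComponent_eq_zero _ _ (by omega), map_zero]

/-- The degree `m` component of an invariant is an invariant. -/
def component (G : Subgroup (GL (Fin d) K)) (m : ℕ) (f : invariants G) : grading G m :=
  ⟨⟨homogeneousComponent m (f : MvPolynomial (Fin d) K), fun σ hσ => by
    rw [act_homogeneousComponent, f.2 σ hσ]⟩, homogeneousComponent_isHomogeneous m _⟩

instance gradedAlgebra (G : Subgroup (GL (Fin d) K)) : GradedAlgebra (grading G) where
  one_mem := isHomogeneous_one (Fin d) K
  mul_mem _ _ _ _ hf hg := IsHomogeneous.mul hf hg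
  decompose' f := ∑ m ∈ Finset.range ((f : MvPolynomial (Fin d) K).totalDegree + 1),
    DirectSum.of (fun m => grading G m) m (component G m f)
  left_inv f := by
    apply Subtype.ext
    rw [map_sum]
    simp only [DirectSum.coeAddMonoidHom_of, AddSubmonoidClass.coe_finsetSum]
    exact sum_homogeneousComponent (f : MvPolynomial (Fin d) K)
  right_inv x := by
    have key : ∀ (x : DirectSum ℕ fun m => grading G m) (m : ℕ),
        component G m (DirectSum.coeAddMonoidHom (grading G) x) = x m := by
      intro x m
      apply Subtype.ext
      apply Subtype.ext
      induction x using DirectSum.induction_on with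
      | zero => simp [component]
      | of i y =>
        simp only [component, DirectSum.coeAddMonoidHom_of]
        rw [homogeneousComponent_of_mem (mem_grading.1 y.2)]
        by_cases h : m = i
        · subst h
          simp
        · rw [DirectSum.of_eq_of_ne _ _ _ h]
          simp [h]
      | add y z hy hz =>
        simp only [component] at hy hz ⊢
        simp only [map_add, DirectSum.add_apply, Subalgebra.coe_add, Submodule.coe_add, hy, hz]
    ext m : 1
    rw [DFinsupp.finsetSum_apply]
    rw [← key x m]
    set f := DirectSum.coeAddMonoidHom (grading G) x with hf
    by_cases hm : m ∈ Finset.range ((f : MvPolynomial (Fin d) K).totalDegree + 1)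
    · rw [Finset.sum_eq_single_of_mem m hm
        (fun i _ hi => DirectSum.of_eq_of_ne _ _ _ (Ne.symm hi))]
      exact DirectSum.of_eq_same _ _
    · rw [Finset.sum_eq_zero (fun i hi => DirectSum.of_eq_of_ne _ _ _
        (fun h => hm (by rw [h]; exact hi)))]
      apply Subtype.ext
      apply Subtype.ext
      simp only [component]
      rw [homogeneousComponent_eq_zero _ _ (by simpa using hm)]
      rfl

/-- The graded maximal ideal `𝔪_G` of `R^G`, i.e. the ideal of invariants without constant term. -/
def gradedMaximalIdeal (G : Subgroup (GL (Fin d) K)) : Ideal (invariants G) :=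
  (HomogeneousIdeal.irrelevant (grading G)).toIdeal

/-- The graded punctured spectrum of `R^G`: all graded prime ideals other than `𝔪_G`. -/
def gradedPuncturedSpectrum (G : Subgroup (GL (Fin d) K)) : Set (PrimeSpectrum (invariants G)) :=
  {p | p.asIdeal.IsHomogeneous (grading G) ∧ p.asIdeal ≠ gradedMaximalIdeal G}

/-- An `A`-module `M` is locally free on `V ⊆ Spec A` if `M_𝔭` is a free `A_𝔭`-module for all
`𝔭 ∈ V`. -/
def LocallyFreeOn (A : Type*) [CommRing A] (M : Type*) [AddCommMonoid M] [Module A M]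
    (V : Set (PrimeSpectrum A)) : Prop :=
  ∀ p ∈ V, Module.Free (Localization.AtPrime p.asIdeal)
    (LocalizedModule p.asIdeal.primeCompl M)

/-- `σ ∈ GL(K^d)` is a pseudo-reflection if it has finite order and its eigenspace for the
eigenvalue `1` has dimension `d - 1`. -/
def IsPseudoReflection (σ : GL (Fin d) K) : Prop :=
  IsOfFinOrder σ ∧
    Module.finrank K (Module.End.eigenspace
      (Matrix.toLin' (σ : Matrix (Fin d) (Fin d) K)) 1) + 1 = d

end PolyInvariant

end

/-! The hypotheses on the `n i` and on the gcds make `G` cyclic of order `n`, generated by one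
diagonal matrix `diagGL x`. A monomial is a weight vector, so `R^χ` is spanned by the monomials
whose weight at `x` is the value of `χ` at the generator. Condition 2 then says that every
coordinate `x j` has order `n`, that is, every `x j` is a faithful character of `G`.

If all `x j` are faithful, each character is a power of each `x j`. A graded prime other than the
maximal one misses some `X j ^ n`. There `R^χ` is free on a power `X j ^ a` of weight `χ`: for `f`
in `R^χ`, `X j ^ (n * a) * f` is `X j ^ a` times the invariant `X j ^ (a * (n - 1)) * f`.

Conversely, localize at the prime of the `j`-th axis. As `R^χ` has rank at most one, freeness yields
a single `f` in `R^χ` dividing every monomial of `R^χ` up to factors that do not vanish on the axis.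
If `f` vanished on the axis, so would one of its prime factors. This factor would divide all
monomials of `R^χ` and thus be a variable up to a unit. But without pseudo-reflections any `d - 1`
coordinates generate all characters, so `R^χ` has a monomial avoiding that variable. Hence `f`
contains a pure power of `X j`, and `χ` is a power of `x j` (`exists_pow_eq_of_free`). Letting `χ`
run through the coordinates `x i` shows that `x j` is faithful. -/

/-! ### Cyclic groups from generators of coprime orders -/

section CyclicGroups

lemma orderOf_prod_of_coprime {D ι : Type*} [CommGroup D] (s : Finset ι) (τ : ι → D)
    (hcop : Pairwise fun i i' => Nat.Coprime (orderOf (τ i)) (orderOf (τ i'))) :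
    orderOf (∏ i ∈ s, τ i) = ∏ i ∈ s, orderOf (τ i) := by
  classical
  induction s using Finset.induction_on with
  | empty => simp
  | insert i s hi ih =>
    rw [Finset.prod_insert hi, Finset.prod_insert hi, ← ih]
    apply (Commute.all _ _).orderOf_mul_eq_mul_orderOf_of_coprime
    rw [ih]
    exact Nat.Coprime.prod_right fun k hk => hcop (fun h => hi (h ▸ hk))

/-- In a commutative group, elements of pairwise coprime orders generate a cyclic group, generated
by their product. -/
lemma closure_range_eq_zpowers_prod {D ι : Type*} [CommGroup D] [Fintype ι] (τ : ι → D)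
    (hcop : Pairwise fun i i' => Nat.Coprime (orderOf (τ i)) (orderOf (τ i'))) :
    Subgroup.closure (Set.range τ) = Subgroup.zpowers (∏ i, τ i) := by
  classical
  apply le_antisymm
  · rw [Subgroup.closure_le]
    rintro _ ⟨i, rfl⟩
    -- The exponent `N` kills every factor except `τ i` and is prime to the order of `τ i`, so a
    -- further power recovers `τ i`.
    set N := ∏ k ∈ Finset.univ.erase i, orderOf (τ k) with hN
    have h1 : (∏ k, τ k) ^ N = τ i ^ N := by
      rw [← Finset.mul_prod_erase Finset.univ τ (Finset.mem_univ i), mul_pow, hN,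
        ← orderOf_prod_of_coprime _ _ hcop, pow_orderOf_eq_one, mul_one]
    have h2 : (orderOf (τ i)).Coprime N :=
      Nat.Coprime.prod_right fun k hk => hcop (Finset.ne_of_mem_erase hk).symm
    obtain ⟨m, hm⟩ := exists_pow_eq_self_of_coprime h2.symm
    have : τ i = (∏ k, τ k) ^ (N * m) := by rw [pow_mul, h1, hm]
    rw [this]
    exact pow_mem (Subgroup.mem_zpowers _) _
  · rw [Subgroup.zpowers_le]
    exact prod_mem fun i _ => Subgroup.subset_closure ⟨i, rfl⟩

end CyclicGroups

/-! ### Freeness of localized modules of rank at most one -/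

section Localization

variable {A M : Type*} [CommRing A] [AddCommMonoid M] [Module A M] {S : Submonoid A}

/-- If, up to denominators in `S`, the module `M` is freely generated by one element, then its
localization at `S` is free. -/
lemma LocalizedModule.free_of_exists_generator (m : M)
    (hgen : ∀ m' : M, ∃ s ∈ S, ∃ a : A, s • m' = a • m)
    (hinj : ∀ a : A, a • m = 0 → a = 0) :
    Module.Free (Localization S) (LocalizedModule S M) := by
  refine Module.Free.of_equiv (LinearEquiv.ofBijective
    (LinearMap.toSpanSingleton (Localization S) (LocalizedModule S M) (LocalizedModule.mk m 1))
    ⟨?_, ?_⟩)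
  · rw [injective_iff_map_eq_zero]
    intro q hq
    induction q using Localization.induction_on with
    | H y =>
      obtain ⟨a, s⟩ := y
      rw [LinearMap.toSpanSingleton_apply, LocalizedModule.mk_smul_mk,
        ← LocalizedModule.zero_mk (1 : S), LocalizedModule.mk_eq] at hq
      obtain ⟨u, hu⟩ := hq
      have h0 : (u : A) * a = 0 := hinj _ (by
        simpa [Submonoid.smul_def, mul_smul] using hu)
      rw [Localization.mk_eq_mk', IsLocalization.mk'_eq_zero_iff]
      exact ⟨u, h0⟩
  · intro q
    induction q using LocalizedModule.induction_on with
    | h m' t =>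
      obtain ⟨s, hs, a, ha⟩ := hgen m'
      refine ⟨Localization.mk a (⟨s, hs⟩ * t), ?_⟩
      rw [LinearMap.toSpanSingleton_apply, LocalizedModule.mk_smul_mk, mul_one, ← ha]
      exact LocalizedModule.mk_cancel_common_left ⟨s, hs⟩ t m'

/-- If the localization of a module of rank at most one over a domain is free, then, up to
denominators in `S`, the module is generated by one element. -/
lemma LocalizedModule.exists_generator_of_free [IsDomain A] (hS : (0 : A) ∉ S)
    (hrank : ∀ m m' : M, m ≠ 0 → ∃ a : A, a ≠ 0 ∧ ∃ a' : A, a • m' = a' • m)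
    [Module.Free (Localization S) (LocalizedModule S M)] :
    ∃ m : M, ∀ m' : M, ∃ s ∈ S, ∃ a : A, s • m' = a • m := by
  have hne : ∀ s : S, (s : A) ≠ 0 := fun s h => hS (h ▸ s.2)
  have hS' : S ≤ nonZeroDivisors A := le_nonZeroDivisors_of_noZeroDivisors hS
  have : Nontrivial (Localization S) :=
    (IsLocalization.injective (Localization S) hS').nontrivial
  let b := Module.Free.chooseBasis (Localization S) (LocalizedModule S M)
  have hsub : Subsingleton (Module.Free.ChooseBasisIndex (Localization S)
      (LocalizedModule S M)) := by
    refine ⟨fun i j => ?_⟩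
    -- Clearing denominators, the relation between `m` and `m'` makes a nonzero multiple of `b j` a
    -- multiple of `b i`, against linear independence.
    by_contra hij
    obtain ⟨m, s, hm⟩ : ∃ m s, LocalizedModule.mk m s = b i := by
      induction b i using LocalizedModule.induction_on with
      | h m s => exact ⟨m, s, rfl⟩
    obtain ⟨m', t, hm'⟩ : ∃ m s, LocalizedModule.mk m s = b j := by
      induction b j using LocalizedModule.induction_on with
      | h m s => exact ⟨m, s, rfl⟩
    have hm0 : m ≠ 0 := by
      rintro rfl
      rw [LocalizedModule.zero_mk] at hm
      exact b.ne_zero i hm.symm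
    obtain ⟨a, ha, a', haa⟩ := hrank m m' hm0
    have e1 : Localization.mk (a * t) (1 : S) • b j = Localization.mk (a' * s) (1 : S) • b i := by
      rw [← hm, ← hm', LocalizedModule.mk_smul_mk, LocalizedModule.mk_smul_mk, one_mul, one_mul,
        mul_comm a, mul_comm a', mul_smul, mul_smul, ← Submonoid.smul_def, ← Submonoid.smul_def,
        LocalizedModule.mk_cancel, LocalizedModule.mk_cancel, haa]
    have e2 := congrArg (fun v => b.repr v j) e1
    simp only [map_smul, Finsupp.smul_apply, Module.Basis.repr_self, smul_eq_mul,
      Finsupp.single_eq_same, mul_one, Finsupp.single_eq_of_ne (Ne.symm hij), mul_zero] at e2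
    rw [Localization.mk_one_eq_algebraMap] at e2
    exact mul_ne_zero ha (hne t)
      ((IsLocalization.injective (Localization S) hS') (e2.trans (map_zero _).symm))
  -- An empty basis means that the localization vanishes, and then `0` serves as generator.
  rcases isEmpty_or_nonempty (Module.Free.ChooseBasisIndex (Localization S)
      (LocalizedModule S M)) with h | ⟨⟨i⟩⟩
  · refine ⟨0, fun m' => ?_⟩
    have := b.repr.toEquiv.subsingleton
    have h0 := Subsingleton.elim (LocalizedModule.mk m' (1 : S)) (LocalizedModule.mk 0 1)
    rw [LocalizedModule.mk_eq] at h0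
    obtain ⟨u, hu⟩ := h0
    exact ⟨u, u.2, 0, by simpa [Submonoid.smul_def] using hu⟩
  · obtain ⟨m, s, hm⟩ : ∃ m s, LocalizedModule.mk m s = b i := by
      induction b i using LocalizedModule.induction_on with
      | h m s => exact ⟨m, s, rfl⟩
    refine ⟨m, fun m' => ?_⟩
    have hu : Unique (Module.Free.ChooseBasisIndex (Localization S)
      (LocalizedModule S M)) := uniqueOfSubsingleton i
    have h1 := b.sum_repr (LocalizedModule.mk m' (1 : S))
    rw [Fintype.sum_subsingleton _ i, ← hm] at h1
    generalize b.repr (LocalizedModule.mk m' (1 : S)) i = q at h1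
    induction q using Localization.induction_on with
    | H y =>
      obtain ⟨a, t⟩ := y
      rw [LocalizedModule.mk_smul_mk, LocalizedModule.mk_eq] at h1
      obtain ⟨u, hu⟩ := h1
      refine ⟨u * (t * s), (u * (t * s)).2, u * a, ?_⟩
      simpa [Submonoid.smul_def, mul_smul] using hu.symm

end Localization

/-! ### Weights of monomials under a cyclic diagonal group -/

namespace PolyInvariant

open MvPolynomial

variable {K : Type*} [Field K] {d : ℕ}

/-- The diagonal matrices, as a homomorphism from the torus to `GL(K^d)`. -/
noncomputable def diagGL : (Fin d → Kˣ) →* GL (Fin d) K :=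
  (Units.map (Matrix.diagonalRingHom (Fin d) K).toMonoidHom).comp
    MulEquiv.piUnits.symm.toMonoidHom

lemma coe_diagGL (x : Fin d → Kˣ) :
    (diagGL x : Matrix (Fin d) (Fin d) K) = Matrix.diagonal fun j => (x j : K) := rfl

lemma diagGL_injective : Function.Injective (diagGL : (Fin d → Kˣ) →* GL (Fin d) K) := by
  intro x y h
  have h1 := congrArg (fun g : GL (Fin d) K => (g : Matrix (Fin d) (Fin d) K)) h
  simp only [coe_diagGL] at h1
  funext j
  exact Units.ext (congrFun (Matrix.diagonal_injective h1) j)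

/-- The character of the torus by which it acts on the monomial with exponent vector `α`. -/
def torusWeight (α : Fin d →₀ ℕ) : (Fin d → Kˣ) →* Kˣ where
  toFun x := ∏ j, x j ^ α j
  map_one' := by simp
  map_mul' x y := by simp [mul_pow, Finset.prod_mul_distrib]

lemma torusWeight_apply (α : Fin d →₀ ℕ) (x : Fin d → Kˣ) :
    torusWeight α x = ∏ j, x j ^ α j := rfl

lemma torusWeight_add (α β : Fin d →₀ ℕ) (x : Fin d → Kˣ) :
    torusWeight (α + β) x = torusWeight α x * torusWeight β x := by
  simp [torusWeight_apply, pow_add, Finset.prod_mul_distrib]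

lemma torusWeight_single (j : Fin d) (k : ℕ) (x : Fin d → Kˣ) :
    torusWeight (Finsupp.single j k) x = x j ^ k := by
  rw [torusWeight_apply, Finset.prod_eq_single j]
  · simp
  · intro i _ hi
    simp [Finsupp.single_eq_of_ne hi]
  · simp

lemma act_diagGL_monomial (x : Fin d → Kˣ) (α : Fin d →₀ ℕ) (c : K) :
    act (diagGL x) (monomial α c) = monomial α ((torusWeight α x : Kˣ) * c : K) := by
  have hX : ∀ j, (∑ i, C ((diagGL x : Matrix (Fin d) (Fin d) K) i j) * X i :
      MvPolynomial (Fin d) K) = C (x j : K) * X j := by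
    intro j
    rw [Finset.sum_eq_single j]
    · simp [coe_diagGL]
    · intro i _ hi
      simp [coe_diagGL, Matrix.diagonal_apply_ne _ hi]
    · simp
  rw [act, aeval_monomial]
  simp only [hX]
  rw [Finsupp.prod_fintype _ _ (by simp), monomial_eq, Finsupp.prod_fintype _ _ (by simp)]
  simp only [mul_pow, Finset.prod_mul_distrib, torusWeight_apply, Units.coe_prod,
    Units.val_pow_eq_pow_val, map_mul, map_prod, map_pow, algebraMap_eq]
  ring

lemma coeff_act_diagGL (x : Fin d → Kˣ) (α : Fin d →₀ ℕ) (f : MvPolynomial (Fin d) K) :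
    coeff α (act (diagGL x) f) = (torusWeight α x : Kˣ) * coeff α f := by
  induction f using MvPolynomial.induction_on' with
  | monomial β c =>
    rw [act_diagGL_monomial, coeff_monomial, coeff_monomial]
    split_ifs with h
    · rw [h]
    · simp
  | add p q hp hq => rw [map_add, coeff_add, hp, hq, coeff_add, mul_add]

/-- The distinguished generator of the cyclic group generated by a diagonal matrix. -/
noncomputable def diagGen (x : Fin d → Kˣ) : Subgroup.zpowers (diagGL x) :=
  ⟨diagGL x, Subgroup.mem_zpowers _⟩

/-- The generator scales each coefficient by the weight of its monomial, so semi-invariance can be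
tested on the support and on the generator alone. -/
lemma mem_semiInvariants_iff {x : Fin d → Kˣ} {χ : Subgroup.zpowers (diagGL x) →* Kˣ}
    {f : MvPolynomial (Fin d) K} :
    f ∈ semiInvariants (Subgroup.zpowers (diagGL x)) χ ↔
      ∀ α, coeff α f ≠ 0 → torusWeight α x = χ (diagGen x) := by
  constructor
  · intro h α hα
    have h1 := congrArg (coeff α) (h (diagGen x))
    rw [diagGen, coeff_act_diagGL, coeff_smul, smul_eq_mul] at h1
    exact Units.ext (mul_right_cancel₀ hα h1)
  · rintro h ⟨_, k, rfl⟩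
    ext α
    have e1 : (⟨diagGL x ^ k, ⟨k, rfl⟩⟩ : Subgroup.zpowers (diagGL x)) = diagGen x ^ k := rfl
    change coeff α (act (diagGL x ^ k) f) = _
    rw [e1, ← map_zpow, coeff_act_diagGL, coeff_smul, smul_eq_mul]
    by_cases hα : coeff α f = 0
    · simp [hα]
    · rw [map_zpow, h α hα, map_zpow]

lemma mem_invariants_iff {x : Fin d → Kˣ} {f : MvPolynomial (Fin d) K} :
    f ∈ invariants (Subgroup.zpowers (diagGL x)) ↔
      ∀ α, coeff α f ≠ 0 → torusWeight α x = 1 := by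
  have h := mem_semiInvariants_iff (x := x) (χ := 1) (f := f)
  rw [MonoidHom.one_apply] at h
  rw [← h]
  constructor
  · intro hf σ
    simpa using hf σ σ.2
  · intro hf σ hσ
    simpa using hf ⟨σ, hσ⟩

lemma monomial_mem_semiInvariants {x : Fin d → Kˣ} {χ : Subgroup.zpowers (diagGL x) →* Kˣ}
    {α : Fin d →₀ ℕ} (c : K) (h : torusWeight α x = χ (diagGen x)) :
    monomial α c ∈ semiInvariants (Subgroup.zpowers (diagGL x)) χ := by
  rw [mem_semiInvariants_iff]
  intro β hβ
  rw [coeff_monomial] at hβ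
  rw [← h, (ite_ne_right_iff.1 hβ).1]

lemma monomial_mem_invariants {x : Fin d → Kˣ} {α : Fin d →₀ ℕ} (c : K)
    (h : torusWeight α x = 1) :
    monomial α c ∈ invariants (Subgroup.zpowers (diagGL x)) := by
  rw [mem_invariants_iff]
  intro β hβ
  rw [coeff_monomial] at hβ
  rw [← h, (ite_ne_right_iff.1 hβ).1]

lemma X_pow_mem_semiInvariants_iff {x : Fin d → Kˣ} {χ : Subgroup.zpowers (diagGL x) →* Kˣ}
    {j : Fin d} {a : ℕ} :
    (X j ^ a : MvPolynomial (Fin d) K) ∈ semiInvariants (Subgroup.zpowers (diagGL x)) χ ↔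
      x j ^ a = χ (diagGen x) := by
  rw [X_pow_eq_monomial, ← torusWeight_single]
  refine ⟨fun h => mem_semiInvariants_iff.1 h _ (by simp), monomial_mem_semiInvariants 1⟩

lemma mul_mem_semiInvariants {x : Fin d → Kˣ} {χ ψ : Subgroup.zpowers (diagGL x) →* Kˣ}
    {f g : MvPolynomial (Fin d) K}
    (hf : f ∈ semiInvariants (Subgroup.zpowers (diagGL x)) χ)
    (hg : g ∈ semiInvariants (Subgroup.zpowers (diagGL x)) ψ) :
    f * g ∈ semiInvariants (Subgroup.zpowers (diagGL x)) (χ * ψ) := by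
  intro σ
  rw [map_mul, hf σ, hg σ, smul_mul_smul_comm, MonoidHom.mul_apply, Units.val_mul]

lemma pow_mem_semiInvariants {x : Fin d → Kˣ} {χ : Subgroup.zpowers (diagGL x) →* Kˣ}
    {f : MvPolynomial (Fin d) K}
    (hf : f ∈ semiInvariants (Subgroup.zpowers (diagGL x)) χ) (k : ℕ) :
    f ^ k ∈ semiInvariants (Subgroup.zpowers (diagGL x)) (χ ^ k) := by
  intro σ
  rw [map_pow, hf σ, smul_pow, MonoidHom.pow_apply, Units.val_pow_eq_pow_val]

lemma mem_semiInvariants_one_iff {G : Subgroup (GL (Fin d) K)} {f : MvPolynomial (Fin d) K} :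
    f ∈ semiInvariants G 1 ↔ f ∈ invariants G :=
  ⟨fun hf σ hσ => by simpa using hf ⟨σ, hσ⟩, fun hf σ => by simpa using hf σ σ.2⟩

lemma exists_character {x : Fin d → Kˣ} {c : Kˣ} (hc : c ^ orderOf x = 1) :
    ∃ χ : Subgroup.zpowers (diagGL x) →* Kˣ, χ (diagGen x) = c := by
  have hg : ∀ y : Subgroup.zpowers (diagGL x), y ∈ Subgroup.zpowers (diagGen x) := by
    rintro ⟨_, k, rfl⟩
    exact ⟨k, rfl⟩
  have ho : orderOf (diagGen x) = orderOf x := by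
    rw [← orderOf_injective _ diagGL_injective x, diagGen, Subgroup.orderOf_mk]
  exact ⟨monoidHomOfForallMemZpowers hg (g' := c) (ho ▸ orderOf_dvd_of_pow_eq_one hc),
    monoidHomOfForallMemZpowers_apply_gen hg _⟩

lemma pow_orderOf_apply (x : Fin d → Kˣ) (j : Fin d) : x j ^ orderOf x = 1 := by
  rw [← Pi.pow_apply, pow_orderOf_eq_one, Pi.one_apply]

lemma character_pow_orderOf {x : Fin d → Kˣ} (χ : Subgroup.zpowers (diagGL x) →* Kˣ) :
    χ ^ orderOf x = 1 := by
  ext ⟨_, k, rfl⟩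
  have h : diagGL x ^ orderOf x = 1 := by rw [← map_pow, pow_orderOf_eq_one, map_one]
  have h1 : (⟨diagGL x ^ k, ⟨k, rfl⟩⟩ : Subgroup.zpowers (diagGL x)) ^ orderOf x = 1 := by
    apply Subtype.ext
    change (diagGL x ^ k) ^ orderOf x = 1
    rw [← zpow_natCast, zpow_comm, zpow_natCast, h, one_zpow]
  have h2 := congrArg χ h1
  rw [map_pow, map_one] at h2
  rw [MonoidHom.pow_apply]
  exact congrArg Units.val h2

/-- The weight is `χ ^ n = 1`. Multiplying by `f ^ (n - 1)` thus replaces division by `f` and bounds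
the rank of `R^χ` by one. -/
lemma pow_sub_one_mul_mem_invariants {x : Fin d → Kˣ} (hx : 0 < orderOf x)
    {χ : Subgroup.zpowers (diagGL x) →* Kˣ} {f g : MvPolynomial (Fin d) K}
    (hf : f ∈ semiInvariants (Subgroup.zpowers (diagGL x)) χ)
    (hg : g ∈ semiInvariants (Subgroup.zpowers (diagGL x)) χ) :
    f ^ (orderOf x - 1) * g ∈ invariants (Subgroup.zpowers (diagGL x)) := by
  have h1 := mul_mem_semiInvariants (pow_mem_semiInvariants hf (orderOf x - 1)) hg
  rw [pow_sub_one_mul hx.ne' χ, character_pow_orderOf] at h1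
  exact mem_semiInvariants_one_iff.1 h1

/-! ### Characters generated by coordinates -/

/-- If the characters `x k`, `k ∈ S`, have trivial common kernel, then they generate all
characters. -/
lemma exists_torusWeight_eq {x : Fin d → Kˣ} (hx : 0 < orderOf x) (S : Set (Fin d))
    (hS : ∀ N : ℕ, (∀ k ∈ S, x k ^ N = 1) → orderOf x ∣ N) {c : Kˣ} (hc : c ^ orderOf x = 1) :
    ∃ α : Fin d →₀ ℕ, (∀ k ∉ S, α k = 0) ∧ torusWeight α x = c := by
  classical
  have : NeZero (orderOf x) := ⟨hx.ne'⟩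
  set y : Fin d → Kˣ := fun k => if k ∈ S then x k else 1 with hy
  set T := Subgroup.closure (Set.range y) with hT
  have hTle : T ≤ rootsOfUnity (orderOf x) K := by
    rw [hT, Subgroup.closure_le]
    rintro _ ⟨k, rfl⟩
    change y k ^ orderOf x = 1
    rw [hy]
    dsimp only
    split_ifs
    · exact pow_orderOf_apply x k
    · exact one_pow _
  have hfin : Finite T := Finite.of_injective _ (Subgroup.inclusion_injective hTle)
  -- The order of `T` annihilates all `x k` with `k ∈ S`, so `orderOf x` divides it. A field has at
  -- most `orderOf x` roots of unity of that exponent, so `T` contains all of them.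
  have hdvd : orderOf x ∣ Nat.card T := by
    refine hS _ fun k hk => ?_
    have h1 := pow_card_eq_one' (x := (⟨y k, Subgroup.subset_closure ⟨_, rfl⟩⟩ : T))
    have h2 : y k ^ Nat.card T = 1 := congrArg Subtype.val h1
    have h3 : y k = x k := if_pos hk
    rwa [h3] at h2
  have hcard : Nat.card (rootsOfUnity (orderOf x) K) ≤ Nat.card T :=
    (card_rootsOfUnity K _).trans (Nat.le_of_dvd Nat.card_pos hdvd)
  have hTeq : T = rootsOfUnity (orderOf x) K := Subgroup.eq_of_le_of_card_ge hTle hcard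
  have hcT : c ∈ T := by
    rw [hTeq]
    exact hc
  obtain ⟨a, ha⟩ := (Subgroup.mem_closure_range_iff_of_fintype).1 hcT
  have hpos : (0 : ℤ) < orderOf x := by exact_mod_cast hx
  -- Membership in `T` gives integer exponents; reducing them modulo `orderOf x` makes them natural
  -- numbers.
  refine ⟨Finsupp.equivFunOnFinite.symm fun k =>
    if k ∈ S then (a k % orderOf x).toNat else 0, fun k hk => by simp [hk], ?_⟩
  rw [ha, torusWeight_apply]
  refine Finset.prod_congr rfl fun k _ => ?_
  rw [Finsupp.coe_equivFunOnFinite_symm, hy]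
  dsimp only
  split_ifs with hk
  · rw [← zpow_natCast, Int.toNat_of_nonneg (Int.emod_nonneg _ hpos.ne')]
    conv_rhs => rw [← Int.emod_add_mul_ediv (a k) (orderOf x), zpow_add, zpow_mul, zpow_natCast]
    rw [pow_orderOf_apply, one_zpow, mul_one]
  · simp

/-- Without pseudo-reflections, the coordinates other than the `i`-th one determine an element of
a diagonal group. -/
lemma orderOf_dvd_of_forall_ne {x : Fin d → Kˣ} (hx : 0 < orderOf x)
    (hrefl : ∀ g ∈ Subgroup.zpowers (diagGL x), ¬ IsPseudoReflection g) (i : Fin d) {N : ℕ}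
    (hN : ∀ k ≠ i, x k ^ N = 1) : orderOf x ∣ N := by
  classical
  rw [orderOf_dvd_iff_pow_eq_one]
  by_contra hne
  have hi : x i ^ N ≠ 1 := by
    intro hi
    refine hne (funext fun k => ?_)
    by_cases hk : k = i
    · rw [hk]
      exact hi
    · exact hN k hk
  -- The power `x ^ N` differs from `1` in the `i`-th coordinate only, so its matrix minus the
  -- identity has rank one: a pseudo-reflection.
  refine hrefl (diagGL (x ^ N)) (by rw [map_pow]; exact pow_mem (Subgroup.mem_zpowers _) _)
    ⟨?_, ?_⟩
  · exact (diagGL : (Fin d → Kˣ) →* GL (Fin d) K).isOfFinOrder ((orderOf_pos_iff.1 hx).pow)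
  · set w : Fin d → K := fun k => (x k ^ N : Kˣ) - 1 with hw
    have h1 : Module.End.eigenspace
        (Matrix.toLin' (diagGL (x ^ N) : Matrix (Fin d) (Fin d) K)) 1 =
        LinearMap.ker (Matrix.toLin' (Matrix.diagonal w)) := by
      ext v
      rw [Module.End.mem_eigenspace_iff, LinearMap.mem_ker, one_smul, coe_diagGL,
        Matrix.toLin'_apply, Matrix.toLin'_apply, funext_iff, funext_iff]
      refine forall_congr' fun k => ?_
      rw [Matrix.mulVec_diagonal, Matrix.mulVec_diagonal, hw, sub_mul, one_mul, Pi.zero_apply,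
        sub_eq_zero]
      rfl
    have h2 := LinearMap.finrank_range_add_finrank_ker (Matrix.toLin' (Matrix.diagonal w))
    have h3 : (Matrix.diagonal w).rank = 1 := by
      rw [Matrix.rank_diagonal, Fintype.card_eq_one_iff]
      refine ⟨⟨i, fun h => hi (Units.ext (sub_eq_zero.1 h))⟩, ?_⟩
      rintro ⟨k, hk⟩
      by_contra hki
      refine hk ?_
      rw [hw]
      dsimp only
      rw [hN k (fun h => hki (Subtype.ext h)), Units.val_one, sub_self]
    have h4 : Module.finrank K (LinearMap.range (Matrix.toLin' (Matrix.diagonal w))) = 1 := h3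
    rw [h4, Module.finrank_fin_fun] at h2
    rw [h1, add_comm, h2]

/-- The powers of `X_j` with exponent at most the group order lie in different modules of
semi-invariants if and only if the `j`-th coordinate is a faithful character. -/
lemma forall_not_exists_semiInvariants_iff {x : Fin d → Kˣ} (hx : 0 < orderOf x) (j : Fin d) :
    (∀ a ∈ Finset.Icc 1 (orderOf x), ∀ b ∈ Finset.Icc 1 (orderOf x), a ≠ b →
      ¬ ∃ χ : Subgroup.zpowers (diagGL x) →* Kˣ,
        (X j ^ a : MvPolynomial (Fin d) K) ∈ semiInvariants (Subgroup.zpowers (diagGL x)) χ ∧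
        (X j ^ b : MvPolynomial (Fin d) K) ∈ semiInvariants (Subgroup.zpowers (diagGL x)) χ) ↔
      orderOf x ∣ orderOf (x j) := by
  simp only [X_pow_mem_semiInvariants_iff]
  have hdvd : orderOf (x j) ∣ orderOf x := orderOf_dvd_of_pow_eq_one (pow_orderOf_apply x j)
  have hpos : 0 < orderOf (x j) := Nat.pos_of_dvd_of_pos hdvd hx
  constructor
  · intro h
    by_contra hnd
    have hlt : orderOf (x j) < orderOf x :=
      lt_of_le_of_ne (Nat.le_of_dvd hx hdvd) fun h' => hnd (h' ▸ dvd_rfl)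
    -- If the order of `x j` is too small, the exponents `1` and `1 + orderOf (x j)` both lie in the
    -- range and have the same weight.
    obtain ⟨χ, hχ⟩ := exists_character (pow_orderOf_apply x j)
    refine h 1 (by rw [Finset.mem_Icc]; omega) (1 + orderOf (x j))
      (by rw [Finset.mem_Icc]; omega) (by omega) ⟨χ, ?_, ?_⟩
    · rw [pow_one, hχ]
    · rw [pow_add, pow_orderOf_eq_one, pow_one, mul_one, hχ]
  · rintro h a ha b hb hab ⟨χ, h1, h2⟩
    have h3 := pow_eq_pow_iff_modEq.1 (h1.trans h2.symm)
    rw [Nat.dvd_antisymm hdvd h] at h3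
    rw [Finset.mem_Icc] at ha hb
    refine hab ?_
    have h4 : (a - 1) ≡ (b - 1) [MOD orderOf x] := by
      apply Nat.ModEq.add_right_cancel' 1
      rwa [Nat.sub_add_cancel ha.1, Nat.sub_add_cancel hb.1]
    have h5 := h4.eq_of_lt_of_lt (by omega) (by omega)
    omega

/-! ### The graded punctured spectrum and the coordinate axes -/

lemma coe_decompose {G : Subgroup (GL (Fin d) K)} (f : invariants G) (m : ℕ) :
    ((DirectSum.decompose (grading G) f m : invariants G) : MvPolynomial (Fin d) K) =
      homogeneousComponent m (f : MvPolynomial (Fin d) K) := by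
  induction f using DirectSum.Decomposition.inductionOn (grading G) with
  | zero => simp
  | @homogeneous i y =>
    rw [homogeneousComponent_of_mem (mem_grading.1 y.2)]
    split_ifs with h
    · subst h
      rw [DirectSum.decompose_of_mem_same _ y.2]
    · rw [DirectSum.decompose_of_mem_ne _ y.2 (Ne.symm h)]
      rfl
  | add f g hf hg => simp [DirectSum.decompose_add, hf, hg]

lemma mem_gradedMaximalIdeal_iff {G : Subgroup (GL (Fin d) K)} {f : invariants G} :
    f ∈ gradedMaximalIdeal G ↔ coeff 0 (f : MvPolynomial (Fin d) K) = 0 := by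
  rw [gradedMaximalIdeal, HomogeneousIdeal.mem_iff, HomogeneousIdeal.mem_irrelevant_iff,
    GradedRing.proj_apply, ← ZeroMemClass.coe_eq_zero, coe_decompose, homogeneousComponent_zero,
    C_eq_zero]

/-- The ideal of the `j`-th coordinate axis, i.e. the one generated by the variables other than
`X_j`. -/
noncomputable def axisIdeal (K : Type*) [Field K] {d : ℕ} (j : Fin d) :
    Ideal (MvPolynomial (Fin d) K) :=
  RingHom.ker (aeval (R := K) (Pi.single j Polynomial.X : Fin d → Polynomial K))

instance isPrime_axisIdeal (j : Fin d) : (axisIdeal K j).IsPrime := RingHom.ker_isPrime _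

lemma mem_axisIdeal_iff {j : Fin d} {f : MvPolynomial (Fin d) K} :
    f ∈ axisIdeal K j ↔ ∀ k, coeff (Finsupp.single j k) f = 0 := by
  have key : ∀ k, (aeval (R := K) (Pi.single j Polynomial.X : Fin d → Polynomial K) f).coeff k =
      coeff (Finsupp.single j k) f := by
    intro k
    induction f using MvPolynomial.induction_on' with
    | monomial β c =>
      rw [aeval_monomial, coeff_monomial, Finsupp.prod_fintype _ _ (by simp)]
      by_cases hβ : ∃ i ≠ j, β i ≠ 0
      · obtain ⟨i, hij, hi⟩ := hβ
        rw [Finset.prod_eq_zero (Finset.mem_univ i) (by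
          rw [Pi.single_eq_of_ne hij, zero_pow hi]), mul_zero, Polynomial.coeff_zero, if_neg]
        rintro rfl
        exact hi (Finsupp.single_eq_of_ne hij)
      · push Not at hβ
        have hβ' : β = Finsupp.single j (β j) := by
          ext i
          by_cases hij : i = j
          · rw [hij, Finsupp.single_eq_same]
          · rw [hβ i hij, Finsupp.single_eq_of_ne hij]
        rw [Finset.prod_eq_single j (fun i _ hi => by rw [hβ i hi, pow_zero]) (by simp),
          Pi.single_eq_same, ← Polynomial.C_eq_algebraMap, Polynomial.coeff_C_mul_X_pow, hβ',
          Finsupp.single_eq_same]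
        refine if_congr ?_ rfl rfl
        rw [(Finsupp.single_injective j).eq_iff, eq_comm]
    | add p q hp hq => rw [map_add, Polynomial.coeff_add, hp, hq, coeff_add]
  rw [axisIdeal, RingHom.mem_ker, Polynomial.ext_iff]
  exact forall_congr' fun k => by rw [← key, Polynomial.coeff_zero]

lemma homogeneousComponent_mem_axisIdeal {j : Fin d} {f : MvPolynomial (Fin d) K}
    (hf : f ∈ axisIdeal K j) (m : ℕ) : homogeneousComponent m f ∈ axisIdeal K j := by
  rw [mem_axisIdeal_iff] at hf ⊢
  intro k
  rw [coeff_homogeneousComponent, hf, ite_self]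

lemma X_pow_notMem_axisIdeal (j : Fin d) (k : ℕ) : (X j ^ k : MvPolynomial (Fin d) K) ∉
    axisIdeal K j := by
  rw [mem_axisIdeal_iff]
  intro h
  simpa [X_pow_eq_monomial] using h k

lemma X_pow_mem_invariants {x : Fin d → Kˣ} (j : Fin d) {k : ℕ} (hk : x j ^ k = 1) :
    (X j ^ k : MvPolynomial (Fin d) K) ∈ invariants (Subgroup.zpowers (diagGL x)) := by
  rw [X_pow_eq_monomial]
  exact monomial_mem_invariants 1 (by rw [torusWeight_single, hk])

/-- The point of the graded punctured spectrum given by the `j`-th coordinate axis. -/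
noncomputable def axisPoint (G : Subgroup (GL (Fin d) K)) (j : Fin d) :
    PrimeSpectrum (invariants G) :=
  ⟨(axisIdeal K j).comap (invariants G).val.toRingHom, Ideal.comap_isPrime _ _⟩

lemma mem_axisPoint {G : Subgroup (GL (Fin d) K)} {j : Fin d} {f : invariants G} :
    f ∈ (axisPoint G j).asIdeal ↔ (f : MvPolynomial (Fin d) K) ∈ axisIdeal K j := Iff.rfl

lemma axisPoint_mem_gradedPuncturedSpectrum {x : Fin d → Kˣ} (hx : 0 < orderOf x) (j : Fin d) :
    axisPoint (Subgroup.zpowers (diagGL x)) j ∈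
      gradedPuncturedSpectrum (Subgroup.zpowers (diagGL x)) := by
  refine ⟨fun m f hf => ?_, fun h => ?_⟩
  · rw [mem_axisPoint, coe_decompose]
    exact homogeneousComponent_mem_axisIdeal hf m
  · have h1 : (⟨X j ^ orderOf x, X_pow_mem_invariants j (pow_orderOf_apply x j)⟩ :
        invariants (Subgroup.zpowers (diagGL x))) ∈ gradedMaximalIdeal _ := by
      rw [mem_gradedMaximalIdeal_iff]
      change coeff 0 (X j ^ orderOf x : MvPolynomial (Fin d) K) = 0
      rw [X_pow_eq_monomial, coeff_monomial, if_neg]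
      intro h0
      exact hx.ne' (Finsupp.single_eq_zero.1 h0)
    rw [← h, mem_axisPoint] at h1
    exact X_pow_notMem_axisIdeal j _ h1

/-- At a point of the graded punctured spectrum, some power `X_j ^ n`, with `n` the group order, is
invertible. -/
lemma exists_X_pow_notMem {x : Fin d → Kˣ}
    {p : PrimeSpectrum (invariants (Subgroup.zpowers (diagGL x)))}
    (hp : p ∈ gradedPuncturedSpectrum (Subgroup.zpowers (diagGL x))) :
    ∃ j, (⟨X j ^ orderOf x, X_pow_mem_invariants j (pow_orderOf_apply x j)⟩ :
      invariants (Subgroup.zpowers (diagGL x))) ∉ p.asIdeal := by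
  by_contra! hall
  refine hp.2 (le_antisymm (fun f hf => ?_) (fun f hf => ?_))
  -- By homogeneity the constant term of an element of `p` lies in `p`; a nonzero one would be a
  -- unit.
  · rw [mem_gradedMaximalIdeal_iff]
    by_contra hc
    have h1 := hp.1 0 hf
    refine p.2.ne_top (Ideal.eq_top_of_isUnit_mem _ h1 ?_)
    have h2 : (DirectSum.decompose (grading (Subgroup.zpowers (diagGL x))) f 0 :
        invariants (Subgroup.zpowers (diagGL x))) = algebraMap K _ (coeff 0 f.1) := by
      apply Subtype.ext
      rw [coe_decompose, homogeneousComponent_zero]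
      rfl
    rw [h2]
    exact (IsUnit.mk0 _ hc).map _
  · rw [mem_gradedMaximalIdeal_iff] at hf
    have hinv := mem_invariants_iff.1 f.2
    have hmem : ∀ α : f.1.support, monomial α.1 (coeff α.1 f.1) ∈
        invariants (Subgroup.zpowers (diagGL x)) := fun α =>
      monomial_mem_invariants _ (hinv _ (mem_support_iff.1 α.2))
    have hsum : f = ∑ α : f.1.support, ⟨monomial α.1 (coeff α.1 f.1), hmem α⟩ := by
      apply Subtype.ext
      rw [AddSubmonoidClass.coe_finsetSum]
      conv_lhs => rw [f.1.as_sum]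
      exact (Finset.sum_coe_sort f.1.support fun α => monomial α (coeff α f.1)).symm
    rw [hsum]
    refine Ideal.sum_mem _ fun α _ => p.2.mem_of_pow_mem (orderOf x) ?_
    have hα := mem_support_iff.1 α.2
    have hα0 : α.1 ≠ 0 := fun h => hα (h ▸ hf)
    obtain ⟨j, hj⟩ := Finsupp.ne_iff.1 hα0
    -- The `n`-th power of a nonconstant invariant monomial is divisible by `X j ^ n` for any
    -- variable `X j` occurring in it, with invariant quotient. It therefore lies in `p`.
    have hle : Finsupp.single j (orderOf x) ≤ orderOf x • α.1 := by
      rw [Finsupp.single_le_iff, Finsupp.smul_apply, smul_eq_mul]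
      exact Nat.le_mul_of_pos_right _ (Nat.pos_of_ne_zero hj)
    have hw : torusWeight (orderOf x • α.1 - Finsupp.single j (orderOf x)) x = 1 := by
      have h1 : torusWeight (orderOf x • α.1) x = 1 := by
        have h0 := hinv _ hα
        rw [torusWeight_apply] at h0 ⊢
        simp only [Finsupp.smul_apply, smul_eq_mul, mul_comm (orderOf x), pow_mul,
          Finset.prod_pow, h0, one_pow]
      rw [← tsub_add_cancel_of_le hle, torusWeight_add, torusWeight_single,
        pow_orderOf_apply, mul_one] at h1
      exact h1
    have hprod : (⟨monomial α.1 (coeff α.1 f.1), hmem α⟩ :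
        invariants (Subgroup.zpowers (diagGL x))) ^ orderOf x =
        ⟨monomial (orderOf x • α.1 - Finsupp.single j (orderOf x)) (coeff α.1 f.1 ^ orderOf x),
          monomial_mem_invariants _ hw⟩ *
        ⟨X j ^ orderOf x, X_pow_mem_invariants j (pow_orderOf_apply x j)⟩ := by
      apply Subtype.ext
      change monomial α.1 (coeff α.1 f.1) ^ orderOf x = monomial _ _ * X j ^ orderOf x
      rw [X_pow_eq_monomial, monomial_mul, mul_one, tsub_add_cancel_of_le hle, monomial_pow]
    rw [hprod]
    exact Ideal.mul_mem_left _ _ (hall j)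

/-! ### The two implications for a cyclic diagonal group -/

set_option synthInstance.maxHeartbeats 200000 in
set_option maxHeartbeats 800000 in
lemma locallyFreeOn_of_forall_orderOf_dvd {x : Fin d → Kˣ} (hx : 0 < orderOf x)
    (h : ∀ j, orderOf x ∣ orderOf (x j)) (χ : Subgroup.zpowers (diagGL x) →* Kˣ) :
    LocallyFreeOn (invariants (Subgroup.zpowers (diagGL x)))
      (semiInvariants (Subgroup.zpowers (diagGL x)) χ)
      (gradedPuncturedSpectrum (Subgroup.zpowers (diagGL x))) := by
  intro p hp
  obtain ⟨j, hj⟩ := exists_X_pow_notMem hp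
  have hχ : χ (diagGen x) ^ orderOf x = 1 := by
    rw [← MonoidHom.pow_apply, character_pow_orderOf, MonoidHom.one_apply]
  -- Faithfulness of `x j` alone lets `S = {j}` suffice, so the monomial of weight `χ` is a pure
  -- power of `X j`.
  obtain ⟨α, hα, hαc⟩ := exists_torusWeight_eq hx {j}
    (fun N hN => (h j).trans (orderOf_dvd_of_pow_eq_one (hN j rfl))) hχ
  have hαj : α = Finsupp.single j (α j) := by
    ext i
    by_cases hij : i = j
    · rw [hij, Finsupp.single_eq_same]
    · rw [hα i hij, Finsupp.single_eq_of_ne hij]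
  set a := α j
  rw [hαj, torusWeight_single] at hαc
  have hXa : (X j ^ a : MvPolynomial (Fin d) K) ∈
      semiInvariants (Subgroup.zpowers (diagGL x)) χ := X_pow_mem_semiInvariants_iff.2 hαc
  refine LocalizedModule.free_of_exists_generator ⟨X j ^ a, hXa⟩ (fun f => ?_) (fun r hr => ?_)
  · have hf : (X j ^ a) ^ (orderOf x - 1) * f.1 ∈ invariants (Subgroup.zpowers (diagGL x)) :=
      pow_sub_one_mul_mem_invariants hx hXa f.2
    refine ⟨⟨X j ^ orderOf x, X_pow_mem_invariants j (pow_orderOf_apply x j)⟩ ^ a,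
      Submonoid.pow_mem p.asIdeal.primeCompl hj a, ⟨_, hf⟩, ?_⟩
    apply Subtype.ext
    change (X j ^ orderOf x) ^ a * f.1 = (X j ^ a) ^ (orderOf x - 1) * f.1 * X j ^ a
    rw [mul_right_comm, pow_sub_one_mul hx.ne', ← pow_mul, ← pow_mul, mul_comm a]
  · have h1 : r.1 * X j ^ a = 0 := congrArg Subtype.val hr
    exact Subtype.ext ((mul_eq_zero.1 h1).resolve_right (pow_ne_zero _ (X_ne_zero j)))

set_option synthInstance.maxHeartbeats 200000 in
set_option maxHeartbeats 800000 in
/-- If the module of semi-invariants of weight `χ` is free at the `j`-th coordinate axis and, for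
every variable, contains a monomial not involving it, then `χ` is a power of the `j`-th
coordinate. -/
lemma exists_pow_eq_of_free {x : Fin d → Kˣ} (hx : 0 < orderOf x) (j : Fin d)
    {χ : Subgroup.zpowers (diagGL x) →* Kˣ}
    (hmon : ∀ k : Fin d, ∃ α : Fin d →₀ ℕ, α k = 0 ∧ torusWeight α x = χ (diagGen x))
    (hfree : Module.Free
      (Localization.AtPrime (axisPoint (Subgroup.zpowers (diagGL x)) j).asIdeal)
      (LocalizedModule (axisPoint (Subgroup.zpowers (diagGL x)) j).asIdeal.primeCompl
        (semiInvariants (Subgroup.zpowers (diagGL x)) χ))) :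
    ∃ a : ℕ, x j ^ a = χ (diagGen x) := by
  obtain ⟨⟨f, hfχ⟩, hf⟩ := LocalizedModule.exists_generator_of_free
    (S := (axisPoint (Subgroup.zpowers (diagGL x)) j).asIdeal.primeCompl)
    (M := semiInvariants (Subgroup.zpowers (diagGL x)) χ)
    (fun h0 => h0 (Ideal.zero_mem _)) (fun f g hf0 => by
      have hpow : f.1 ^ orderOf x ∈ invariants (Subgroup.zpowers (diagGL x)) := by
        rw [← pow_sub_one_mul hx.ne' f.1]
        exact pow_sub_one_mul_mem_invariants hx f.2 f.2
      have hmul : f.1 ^ (orderOf x - 1) * g.1 ∈ invariants (Subgroup.zpowers (diagGL x)) :=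
        pow_sub_one_mul_mem_invariants hx f.2 g.2
      refine ⟨⟨_, hpow⟩, fun h0 => ?_, ⟨_, hmul⟩, ?_⟩
      · have h1 : f.1 ^ orderOf x = 0 := congrArg Subtype.val h0
        exact hf0 (Subtype.ext (pow_eq_zero_iff hx.ne' |>.1 h1))
      · apply Subtype.ext
        change f.1 ^ orderOf x * g.1 = f.1 ^ (orderOf x - 1) * g.1 * f.1
        rw [mul_right_comm, pow_sub_one_mul hx.ne'])
  have hdiv : ∀ α : Fin d →₀ ℕ, torusWeight α x = χ (diagGen x) →
      ∃ s ∉ axisIdeal K j, f ∣ s * monomial α 1 := by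
    intro α hα
    obtain ⟨s, hs, a, ha⟩ := hf ⟨_, monomial_mem_semiInvariants 1 hα⟩
    refine ⟨s.1, hs, a.1, ?_⟩
    have h1 : s.1 * monomial α 1 = a.1 * f := congrArg Subtype.val ha
    rw [h1, mul_comm]
  by_cases hfP : f ∈ axisIdeal K j
  · exfalso
    obtain ⟨α₀, -, hα₀⟩ := hmon j
    have hf0 : f ≠ 0 := by
      rintro rfl
      obtain ⟨s, hs, hdvd⟩ := hdiv α₀ hα₀
      rw [zero_dvd_iff, mul_eq_zero] at hdvd
      rcases hdvd with h | h
      · exact hs (h ▸ Ideal.zero_mem _)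
      · exact one_ne_zero (monomial_eq_zero.1 h)
    obtain ⟨q, hqP, hq, hqf⟩ : ∃ q ∈ axisIdeal K j, Prime q ∧ q ∣ f := by
      obtain ⟨u, hu, hprod⟩ := UniqueFactorizationMonoid.exists_prime_factors f hf0
      have h1 : u.prod ∈ axisIdeal K j := by
        obtain ⟨v, hv⟩ := hprod.symm
        rw [← hv]
        exact Ideal.mul_mem_right _ _ hfP
      obtain ⟨q, hqu, hqP⟩ := ((isPrime_axisIdeal j).multiset_prod_mem_iff_exists_mem u).1 h1
      exact ⟨q, hqP, hu q hqu, (Multiset.dvd_prod hqu).trans hprod.dvd⟩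
    -- The prime `q` divides `s * X^α` but not `s`, since `s` lies outside the axis ideal and `q`
    -- inside. So `q` divides a variable occurring in `X^α`.
    have hqmon : ∀ α : Fin d →₀ ℕ, torusWeight α x = χ (diagGen x) →
        ∃ l, α l ≠ 0 ∧ q ∣ (X l : MvPolynomial (Fin d) K) := by
      intro α hα
      obtain ⟨s, hs, hdvd⟩ := hdiv α hα
      have h1 := (hq.dvd_or_dvd (hqf.trans hdvd)).resolve_left
        fun ⟨r, hr⟩ => hs (hr ▸ Ideal.mul_mem_right _ _ hqP)
      rw [monomial_eq, C_1, one_mul, Finsupp.prod, hq.dvd_finsetProd_iff] at h1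
      obtain ⟨l, hl, hql⟩ := h1
      exact ⟨l, Finsupp.mem_support_iff.1 hl, hq.dvd_of_dvd_pow hql⟩
    obtain ⟨l, -, hl⟩ := hqmon α₀ hα₀
    -- Now `q` is associated to `X l`; a monomial of `R^χ` without `X l` gives the contradiction.
    obtain ⟨β, hβ, hβχ⟩ := hmon l
    obtain ⟨l', hl', hql'⟩ := hqmon β hβχ
    have h2 : (X l : MvPolynomial (Fin d) K) ∣ X l' :=
      ((hq.associated_of_dvd X_prime hl).symm.dvd).trans hql'
    rw [X_dvd_X] at h2
    exact hl' (h2 ▸ hβ)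
  · rw [mem_axisIdeal_iff] at hfP
    push Not at hfP
    obtain ⟨a, ha⟩ := hfP
    refine ⟨a, ?_⟩
    rw [← torusWeight_single]
    exact mem_semiInvariants_iff.1 hfχ _ ha

lemma forall_orderOf_dvd_of_locallyFreeOn {x : Fin d → Kˣ} (hx : 0 < orderOf x)
    (hrefl : ∀ g ∈ Subgroup.zpowers (diagGL x), ¬ IsPseudoReflection g)
    (h : ∀ χ : Subgroup.zpowers (diagGL x) →* Kˣ,
      LocallyFreeOn (invariants (Subgroup.zpowers (diagGL x)))
        (semiInvariants (Subgroup.zpowers (diagGL x)) χ)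
        (gradedPuncturedSpectrum (Subgroup.zpowers (diagGL x)))) (j : Fin d) :
    orderOf x ∣ orderOf (x j) := by
  rw [orderOf_dvd_iff_pow_eq_one]
  funext i
  rw [Pi.pow_apply, Pi.one_apply]
  -- The character to test is the `i`-th coordinate: being a power of `x j`, it is killed by the
  -- order of `x j`.
  obtain ⟨χ, hχ⟩ := exists_character (pow_orderOf_apply x i)
  obtain ⟨a, ha⟩ := exists_pow_eq_of_free hx j (χ := χ) (fun k => by
    obtain ⟨α, hα, hαc⟩ := exists_torusWeight_eq hx {k}ᶜ
      (fun N hN => orderOf_dvd_of_forall_ne hx hrefl k hN) (pow_orderOf_apply x i)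
    exact ⟨α, hα k (by simp), hαc.trans hχ.symm⟩)
    (h χ _ (axisPoint_mem_gradedPuncturedSpectrum hx j))
  rw [← hχ, ← ha, ← pow_mul, mul_comm, pow_mul, pow_orderOf_eq_one, one_pow]

end PolyInvariant

/-! ### Reduction to a cyclic diagonal group -/

theorem corollary3p13 {K : Type*} [Field K] [IsAlgClosed K] (d : ℕ) (hd : 2 ≤ d)
    (ℓ : ℕ) (σ : Fin ℓ → GL (Fin d) K)
    (n : Fin ℓ → ℕ) (hn : ∀ i, 0 < n i)
    (ξ : Fin ℓ → K) (hξ : ∀ i, IsPrimitiveRoot (ξ i) (n i))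
    (t : Fin ℓ → Fin d → ℕ)
    (hσ : ∀ i, (σ i : Matrix (Fin d) (Fin d) K) = Matrix.diagonal fun j => ξ i ^ t i j)
    (ht : ∀ i, Nat.gcd (Finset.univ.gcd (t i)) (n i) = 1)
    (G : Subgroup (GL (Fin d) K)) (hG : G = Subgroup.closure (Set.range σ))
    (hfin : Finite G) (hchar : ¬ ringChar K ∣ Nat.card G)
    (hcop : Pairwise fun i i' => Nat.Coprime (n i) (n i'))
    (hrefl : ∀ g ∈ G, ¬ PolyInvariant.IsPseudoReflection g) :
    (∀ χ : G →* Kˣ, PolyInvariant.LocallyFreeOn (PolyInvariant.invariants G)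
        (PolyInvariant.semiInvariants G χ) (PolyInvariant.gradedPuncturedSpectrum G)) ↔
      ∀ j : Fin d, ∀ a ∈ Finset.Icc 1 (∏ i, n i), ∀ b ∈ Finset.Icc 1 (∏ i, n i), a ≠ b →
        ¬ ∃ χ : G →* Kˣ,
          (MvPolynomial.X j ^ a : MvPolynomial (Fin d) K) ∈ PolyInvariant.semiInvariants G χ ∧
          (MvPolynomial.X j ^ b : MvPolynomial (Fin d) K) ∈ PolyInvariant.semiInvariants G χ := by
  have hξ' : ∀ i, ∃ u : Kˣ, (u : K) = ξ i := fun i => (hξ i).isUnit (hn i).ne'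
  choose u hu using hξ'
  set τ : Fin ℓ → Fin d → Kˣ := fun i j => u i ^ t i j with hτ
  have hστ : σ = PolyInvariant.diagGL ∘ τ := by
    funext i
    apply Units.ext
    rw [hσ i, Function.comp_apply, PolyInvariant.coe_diagGL]
    congr 1
    funext j
    rw [hτ, ← hu i, Units.val_pow_eq_pow_val]
  have hord : ∀ i, orderOf (τ i) = n i := by
    intro i
    have hui : orderOf (u i) = n i := by
      rw [← orderOf_units, hu, (hξ i).eq_orderOf]
    apply Nat.dvd_antisymm
    · apply orderOf_dvd_of_pow_eq_one
      funext j
      change (u i ^ t i j) ^ n i = 1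
      rw [← hui, pow_right_comm, pow_orderOf_eq_one, one_pow]
    -- Divisibility for each `j` passes to the gcd of the `t i j`, which is prime to `n i` by `ht`.
    · have h1 : ∀ j, n i ∣ orderOf (τ i) * t i j := by
        intro j
        have h2 : (u i ^ t i j) ^ orderOf (τ i) = 1 := PolyInvariant.pow_orderOf_apply (τ i) j
        rw [← hui, mul_comm, orderOf_dvd_iff_pow_eq_one, pow_mul, h2]
      have h3 : n i ∣ orderOf (τ i) * Finset.univ.gcd (t i) := by
        have h4 : n i ∣ Finset.univ.gcd fun j => orderOf (τ i) * t i j :=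
          Finset.dvd_gcd fun j _ => h1 j
        rwa [Finset.gcd_mul_left, normalize_eq] at h4
      exact Nat.Coprime.dvd_of_dvd_mul_right (Nat.Coprime.symm (ht i)) h3
  have hcop' : Pairwise fun i i' => Nat.Coprime (orderOf (τ i)) (orderOf (τ i')) := by
    simpa only [hord] using hcop
  set x := ∏ i, τ i with hxdef
  have hxn : ∏ i, n i = orderOf x := by
    rw [hxdef, orderOf_prod_of_coprime _ _ hcop']
    simp only [hord]
  have hx : 0 < orderOf x := hxn ▸ Finset.prod_pos fun i _ => hn i
  have hGx : G = Subgroup.zpowers (PolyInvariant.diagGL x) := by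
    rw [hG, hστ, Set.range_comp, ← MonoidHom.map_closure,
      closure_range_eq_zpowers_prod _ hcop', MonoidHom.map_zpowers]
  clear_value x
  subst hGx
  rw [hxn]
  simp only [PolyInvariant.forall_not_exists_semiInvariants_iff hx]
  exact ⟨PolyInvariant.forall_orderOf_dvd_of_locallyFreeOn hx hrefl,
    PolyInvariant.locallyFreeOn_of_forall_orderOf_dvd hx⟩
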